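/- **Theorem 1.1.** For integers $0\le r\le N$ and $n\ge 0$, let $p_{r,N}(n)$ be the number of partitions of $n$ into parts $\le N$ in which every integer $i$ with $1\le i\le r$ appears as a part at least once and every integer $i$ with $r<i\le N$ appears as a part exactly once. Set $$\omega(n)=\sum_{N\ge 0,\ 0\le r\le N}(-1)^N p_{r,N}(n),$$ a sum with only finitely many nonzero terms. Call two pairs of integers $(x,y)$ and $(x',y')$ equivalent if $x'+y'\sqrt3=(a+b\sqrt3)(x+y\sqrt3)$ for some integers $a,b$ with $a^2-3b^2=1$. For a positive integer $m\equiv 2\pmod{24}$, let $I(m)$ be the excess of the number of inequivalent integer solutions $(x,y)$, $y>0$, of $-m=x^2-3y^2$ with $x+3y\equiv 4\pmod{12}$ over the number of inequivalent integer solutions $(x,y)$, $y>0$, of the same equation with $x+3y\equiv 10\pmod{12}$; that is, the number of equivalence classes containing a solution of the first kind minus the number of those containing a solution of the second kind, both numbers being finite. Then for every integer $n\ge 0$, $$\omega(n)=I(24n+2).$$ -/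

import Mathlib

/-- `p_{r,N}(n)`: the number of partitions of `n` into parts `≤ N` in which every
`1 ≤ i ≤ r` appears at least once and every `r < i ≤ N` appears exactly once. -/
noncomputable def partitionCount (r N n : ℕ) : ℕ :=
  Nat.card {π : n.Partition //
    (∀ i ∈ π.parts, i ≤ N) ∧
    (∀ i ∈ Finset.Icc 1 r, 1 ≤ π.parts.count i) ∧
    (∀ i ∈ Finset.Ioc r N, π.parts.count i = 1)}

/-- The pairs `(N, r)` with `0 ≤ r ≤ N` that contribute to the signed sum `ω(n)`. -/
def omegaSupport (n : ℕ) : Set (ℕ × ℕ) :=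
  {P | P.2 ≤ P.1 ∧ partitionCount P.2 P.1 n ≠ 0}

/-- `ω(n) = ∑_{N ≥ 0, 0 ≤ r ≤ N} (-1)^N p_{r,N}(n)`, summed over all pairs `(N, r)`
(only finitely many terms are nonzero). -/
noncomputable def omega (n : ℕ) : ℤ :=
  ∑ᶠ P ∈ {P : ℕ × ℕ | P.2 ≤ P.1}, (-1 : ℤ) ^ P.1 * (partitionCount P.2 P.1 n : ℤ)

/-- Two pairs `(x, y)`, `(x', y')` are equivalent if
`x' + y' √3 = (a + b √3) (x + y √3)` for integers `a`, `b` with `a² - 3 b² = 1`,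
that is, `x' + y' √3 = ± (2 + √3)^j (x + y √3)` for some integer `j`. -/
def solutionSetoid : Setoid (ℤ × ℤ) where
  r s t := ∃ a b : ℤ, a ^ 2 - 3 * b ^ 2 = 1 ∧
    t.1 = a * s.1 + 3 * b * s.2 ∧ t.2 = b * s.1 + a * s.2
  iseqv :=
    { refl := fun s => ⟨1, 0, by norm_num, by ring, by ring⟩
      symm := by
        rintro s t ⟨a, b, h, h1, h2⟩
        refine ⟨a, -b, by linear_combination h, ?_, ?_⟩
        · rw [h1, h2]; linear_combination (-s.1) * h
        · rw [h1, h2]; linear_combination (-s.2) * h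
      trans := by
        rintro s t u ⟨a, b, h, h1, h2⟩ ⟨c, d, k, k1, k2⟩
        refine ⟨a * c + 3 * b * d, a * d + b * c, ?_, ?_, ?_⟩
        · linear_combination (c ^ 2 - 3 * d ^ 2) * h + k
        · rw [k1, h1, h2]; ring
        · rw [k2, h1, h2]; ring }

/-- The integer solutions `(x, y)` of `-m = x² - 3 y²` with `y > 0` and
`x + 3 y ≡ c (mod 12)`. -/
def solutions (m c : ℤ) : Set (ℤ × ℤ) :=
  {s | -m = s.1 ^ 2 - 3 * s.2 ^ 2 ∧ 0 < s.2 ∧ s.1 + 3 * s.2 ≡ c [ZMOD 12]}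

/-- The equivalence classes that are represented by an element of `solutions m c`. -/
def solutionClasses (m c : ℤ) : Set (Quotient solutionSetoid) :=
  Quotient.mk solutionSetoid '' solutions m c

/-- `I(m)`: the number of inequivalent solutions with `x + 3 y ≡ 4 (mod 12)` minus the
number of those with `x + 3 y ≡ 10 (mod 12)`. -/
noncomputable def excess (m : ℤ) : ℤ :=
  ((solutionClasses m 4).ncard : ℤ) - ((solutionClasses m 10).ncard : ℤ)

/-! Removing one copy of each part 1, …, N turns the partitions counted by `partitionCount r N` into
partitions with parts at most r, so ω has generating function ∑_N (-1)^N q^(N(N+1)/2) ∑_{r ≤ N}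
1/(q;q)_r. A Bailey pair relative to a = q (`bailey_pair`) writes the inner sum through `heckePoly`.
After exchanging summations, the conjugate pair (`conjugate_pair`) evaluates the sum over N, all
modulo q^M. What results is the Hecke-type series ∑ (-1)^(k+j) q^(k(k+1)/2 - j(3j+1)/2) over 2|j| ≤
k (`omega_eq_sum`). With x = 6j + 1 and y = 2k + 1, exponent n means x² - 3y² = -(24n + 2). Also x +
3y = 6(k + j) + 4, so the sign (-1)^(k+j) separates the residues 4 and 10 mod 12. The cone 2|j| ≤ k
becomes 2|x| < 3y, a fundamental domain for the powers of 7 + 4√3 = (2 + √3)², the units that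
preserve y > 0 and x ≡ 1 (mod 3). Hence each class is counted exactly once. -/

/-! ### Generating functions of bounded partitions -/

open PowerSeries in
/-- The generating function `1 / (q; q)_r` of partitions into parts at most `r`. -/
noncomputable def boundedGF (r : ℕ) : PowerSeries ℤ :=
  PowerSeries.mk fun m => ((Nat.Partition.restricted m (· ≤ r)).card : ℤ)

/-- The finite product `(q; q)_n`. -/
noncomputable def qProd (n : ℕ) : PowerSeries ℤ :=
  ∏ i ∈ Finset.range n, (1 - PowerSeries.X ^ (i + 1))

/-- Triangular numbers. -/
def tri (n : ℕ) : ℕ := ∑ i ∈ Finset.range (n + 1), i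

/-- The polynomials `∑_{|j| ≤ r} (-1)^(r + j) q^(r(3r+1)/2 - j(3j+1)/2)`, defined recursively. -/
noncomputable def heckePoly : ℕ → PowerSeries ℤ
  | 0 => 1
  | r + 1 => 1 + PowerSeries.X ^ (r + 1) - PowerSeries.X ^ (3 * r + 2) * heckePoly r

theorem tri_succ (n : ℕ) : tri (n + 1) = tri n + (n + 1) := Finset.sum_range_succ _ _

theorem two_mul_tri (n : ℕ) : 2 * tri n = n * (n + 1) := by
  induction n with
  | zero => rfl
  | succ n ih => rw [tri_succ, mul_add, ih]; ring

theorem le_tri (n : ℕ) : n ≤ tri n := by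
  cases n with
  | zero => exact Nat.zero_le _
  | succ n => rw [tri_succ]; omega

theorem qProd_succ (n : ℕ) : qProd (n + 1) = (1 - PowerSeries.X ^ (n + 1)) * qProd n := by
  rw [qProd, Finset.prod_range_succ, mul_comm, qProd]

theorem qProd_zero : qProd 0 = 1 := by simp [qProd]

theorem boundedGF_zero : boundedGF 0 = 1 := by
  ext m
  rw [boundedGF, PowerSeries.coeff_mk, PowerSeries.coeff_one]
  split_ifs with h
  · subst h
    simp [Nat.Partition.restricted]
  · norm_cast
    rw [Finset.card_eq_zero, Nat.Partition.restricted, Finset.filter_eq_empty_iff]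
    intro p _ hp
    have h0 : p.parts = 0 := Multiset.eq_zero_of_forall_notMem fun i hi => by
      have := p.parts_pos hi
      have := hp i hi
      omega
    exact h (by rw [← p.parts_sum, h0, Multiset.sum_zero])

theorem card_restricted_succ (r m : ℕ) :
    (Nat.Partition.restricted m (· ≤ r + 1)).card =
      (Nat.Partition.restricted m (· ≤ r)).card +
        if r + 1 ≤ m then (Nat.Partition.restricted (m - (r + 1)) (· ≤ r + 1)).card else 0 := by
  classical
  rw [← Finset.card_filter_add_card_filter_not (s := Nat.Partition.restricted m (· ≤ r + 1))
    (fun p => r + 1 ∈ p.parts), add_comm]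
  congr 1
  · congr 1
    ext p
    simp only [Nat.Partition.restricted, Finset.mem_filter, Finset.mem_univ, true_and]
    constructor
    · rintro ⟨h1, h2⟩ i hi
      have := h1 i hi
      have : i ≠ r + 1 := fun h => h2 (h ▸ hi)
      omega
    · intro h
      exact ⟨fun i hi => (h i hi).trans (Nat.le_succ r), fun hi => by have := h _ hi; omega⟩
  -- Partitions containing the part r + 1 lose one copy of it.
  · split_ifs with hm
    · refine Finset.card_bij'
        (fun p hp => Nat.Partition.partitionWithPartEquiv (Nat.le_add_left 1 r) hm
          ⟨p, (Finset.mem_filter.1 hp).2⟩)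
        (fun p _ => ((Nat.Partition.partitionWithPartEquiv (Nat.le_add_left 1 r) hm).symm p).1)
        ?_ ?_ ?_ ?_
      · intro p hp
        simp only [Nat.Partition.restricted, Finset.mem_filter, Finset.mem_univ, true_and] at hp ⊢
        intro i hi
        rw [Nat.Partition.partitionWithPartEquiv_apply_parts] at hi
        exact hp.1 i (Multiset.mem_of_mem_erase hi)
      · intro p hp
        simp only [Nat.Partition.restricted, Finset.mem_filter, Finset.mem_univ, true_and] at hp ⊢
        refine ⟨?_, ((Nat.Partition.partitionWithPartEquiv (Nat.le_add_left 1 r) hm).symm p).2⟩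
        intro i hi
        rw [Nat.Partition.partitionWithPartEquiv_symm_apply_parts, Multiset.mem_cons] at hi
        rcases hi with hi | hi
        · exact hi.le
        · exact hp i hi
      · intro p hp
        simp
      · intro p hp
        simp
    · rw [Finset.card_eq_zero, Finset.filter_eq_empty_iff]
      intro p _ hp
      exact hm (p.le_of_mem_parts hp)

theorem one_sub_mul_boundedGF (r : ℕ) :
    boundedGF r = (1 - PowerSeries.X ^ (r + 1)) * boundedGF (r + 1) := by
  ext m
  rw [sub_mul, one_mul, map_sub, PowerSeries.coeff_X_pow_mul']
  simp only [boundedGF, PowerSeries.coeff_mk]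
  rw [card_restricted_succ r m]
  split_ifs <;> push_cast <;> ring

theorem qProd_mul_boundedGF (n : ℕ) : qProd n * boundedGF n = 1 := by
  induction n with
  | zero => rw [qProd_zero, boundedGF_zero, one_mul]
  | succ n ih => rw [← ih, qProd_succ, one_sub_mul_boundedGF n]; ring

/-! ### The Bailey pair -/

-- The increment of the Bailey sum from N to N + 1 telescopes in r. At ρ = N the first term on the
-- right cancels the q^(3N+2) part of `heckePoly (N + 1)` in the extra summand r = N + 1, and only
-- 1/(q;q)_(N+1) survives.
open PowerSeries in
theorem bailey_difference (N ρ : ℕ) (h : ρ ≤ N) :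
    ∑ r ∈ Finset.range (ρ + 1), heckePoly r * (1 - X ^ (2 * r + 1)) *
      (qProd (N + 1) * boundedGF (N + 1 - r) * boundedGF (N + 1 + r + 1) -
        qProd N * boundedGF (N - r) * boundedGF (N + r + 1)) =
    X ^ (2 * ρ + 2 + N) * heckePoly ρ * (1 - X ^ (ρ + 1)) * qProd N *
        boundedGF (N - ρ) * boundedGF (N + ρ + 2) +
      qProd N * (boundedGF N * boundedGF (N + 1) - boundedGF (N - ρ) * boundedGF (N + ρ + 1)) := by
  induction ρ with
  | zero =>
    rw [Finset.sum_range_one, qProd_succ]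
    simp only [heckePoly, Nat.sub_zero, add_zero]
    rw [one_sub_mul_boundedGF N, one_sub_mul_boundedGF (N + 1)]
    ring
  | succ ρ ih =>
    obtain ⟨d, rfl⟩ := Nat.exists_eq_add_of_le h
    rw [Finset.sum_range_succ, ih (by omega), qProd_succ]
    have e1 : ρ + 1 + d - ρ = d + 1 := by omega
    have e2 : ρ + 1 + d + 1 - (ρ + 1) = d + 1 := by omega
    have e3 : ρ + 1 + d - (ρ + 1) = d := by omega
    rw [e1, e2, e3, one_sub_mul_boundedGF d]
    have e4 : ρ + 1 + d + 1 + (ρ + 1) + 1 = ρ + 1 + d + ρ + 3 := by omega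
    have e5 : ρ + 1 + d + (ρ + 1) + 1 = ρ + 1 + d + ρ + 2 := by omega
    have e6 : ρ + 1 + d + (ρ + 1) + 2 = ρ + 1 + d + ρ + 3 := by omega
    rw [e4, e5, e6, one_sub_mul_boundedGF (ρ + 1 + d + ρ + 1),
      one_sub_mul_boundedGF (ρ + 1 + d + ρ + 2), heckePoly]
    ring

open PowerSeries in
/-- The Bailey pair relative to `a = q` behind the Hecke-type expansion. -/
theorem bailey_pair (n : ℕ) :
    ∑ r ∈ Finset.range (n + 1), heckePoly r * (1 - X ^ (2 * r + 1)) *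
      (qProd n * boundedGF (n - r) * boundedGF (n + r + 1)) =
    ∑ r ∈ Finset.range (n + 1), boundedGF r := by
  induction n with
  | zero =>
    simp only [zero_add, Finset.sum_range_one, heckePoly, qProd_zero, boundedGF_zero]
    have := one_sub_mul_boundedGF 0
    rw [boundedGF_zero] at this
    simpa [boundedGF_zero] using this.symm
  | succ n ih =>
    rw [Finset.sum_range_succ (fun r => boundedGF r), ← ih, Finset.sum_range_succ]
    have h := bailey_difference n n le_rfl
    simp only [mul_sub, Finset.sum_sub_distrib] at h ⊢
    rw [sub_eq_iff_eq_add] at h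
    rw [h, Nat.sub_self, Nat.sub_self, boundedGF_zero, heckePoly, qProd_succ]
    have e1 : n + 1 + (n + 1) + 1 = n + n + 3 := by omega
    rw [e1, one_sub_mul_boundedGF (n + n + 1), one_sub_mul_boundedGF (n + n + 2)]
    linear_combination boundedGF (n + 1) * qProd_mul_boundedGF n

/-! ### The conjugate Bailey pair and the Hecke-type expansion -/

open PowerSeries in
/-- The terms of the conjugate Bailey pair. -/
noncomputable def conjTerm (n r : ℕ) : PowerSeries ℤ :=
  (-1) ^ n * X ^ tri n * qProd n * (if r ≤ n then boundedGF (n - r) else 0) * boundedGF (n + r + 1)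

-- The right side is divisible by q^(tri M), so in the limit the sum for r + 1 is -q^(r+1) times the
-- sum for r; iterating produces (-1)^r q^(tri r).
open PowerSeries in
theorem sum_conjTerm_succ (r M : ℕ) :
    ∑ n ∈ Finset.range M, (conjTerm n (r + 1) + X ^ (r + 1) * conjTerm n r) =
      -(1 + X ^ (r + 1)) * (-1) ^ M * X ^ tri M * qProd M *
        (if r + 1 ≤ M then boundedGF (M - (r + 1)) else 0) * boundedGF (M + r + 1) := by
  induction M with
  | zero => simp
  | succ M ih =>
    rw [Finset.sum_range_succ, ih, conjTerm, conjTerm, tri_succ, qProd_succ]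
    rcases lt_trichotomy M r with h | rfl | h
    · simp [show ¬ r + 1 ≤ M by omega, show ¬ r ≤ M by omega]
    · have e : M + 1 + M + 1 = M + M + 2 := by omega
      simp only [show ¬ M + 1 ≤ M by omega, le_refl, if_true, if_false, Nat.sub_self,
        boundedGF_zero, e]
      rw [one_sub_mul_boundedGF (M + M + 1)]
      ring
    · obtain ⟨d, rfl⟩ := Nat.exists_eq_add_of_le (Nat.succ_le_of_lt h)
      have e1 : r.succ + d - (r + 1) = d := by omega
      have e2 : r.succ + d - r = d + 1 := by omega
      have e3 : r.succ + d + 1 - (r + 1) = d + 1 := by omega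
      have e4 : r.succ + d + (r + 1) + 1 = r.succ + d + r + 2 := by omega
      have e5 : r.succ + d + 1 + r + 1 = r.succ + d + r + 2 := by omega
      simp only [show r + 1 ≤ r.succ + d by omega, show r ≤ r.succ + d by omega,
        show r + 1 ≤ r.succ + d + 1 by omega, if_true, e1, e2, e3, e4, e5]
      rw [one_sub_mul_boundedGF d, one_sub_mul_boundedGF (r.succ + d + r + 1)]
      simp only [Nat.succ_eq_add_one]
      ring

open PowerSeries in
theorem sum_conjTerm_zero (M : ℕ) :
    ∑ n ∈ Finset.range M, conjTerm n 0 = 1 - (-1) ^ M * X ^ tri M * boundedGF M := by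
  induction M with
  | zero => simp [tri, boundedGF_zero]
  | succ M ih =>
    rw [Finset.sum_range_succ, ih, conjTerm, tri_succ]
    simp only [Nat.zero_le, if_true, Nat.sub_zero, add_zero]
    linear_combination (-1) ^ M * X ^ tri M * boundedGF (M + 1) * qProd_mul_boundedGF M -
      (-1) ^ M * X ^ tri M * one_sub_mul_boundedGF M

open PowerSeries in
theorem conjugate_pair (M r : ℕ) :
    (X : PowerSeries ℤ) ^ M ∣
      ∑ n ∈ Finset.range M, conjTerm n r - (-1) ^ r * X ^ tri r := by
  induction r with
  | zero =>
    rw [sum_conjTerm_zero]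
    refine (pow_dvd_pow X (le_tri M)).trans ⟨-(-1) ^ M * boundedGF M, ?_⟩
    simp [tri]
    ring
  | succ r ih =>
    have h := sum_conjTerm_succ r M
    rw [Finset.sum_add_distrib, ← Finset.mul_sum] at h
    have h1 : (X : PowerSeries ℤ) ^ M ∣ -(1 + X ^ (r + 1)) * (-1) ^ M * X ^ tri M * qProd M *
        (if r + 1 ≤ M then boundedGF (M - (r + 1)) else 0) * boundedGF (M + r + 1) := by
      refine (pow_dvd_pow X (le_tri M)).trans ⟨-(1 + X ^ (r + 1)) * (-1) ^ M * qProd M *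
        (if r + 1 ≤ M then boundedGF (M - (r + 1)) else 0) * boundedGF (M + r + 1), ?_⟩
      ring
    have h2 := dvd_sub h1 (ih.mul_left (X ^ (r + 1)))
    rw [← h] at h2
    convert h2 using 1
    rw [tri_succ]
    ring

open PowerSeries in
/-- The Hecke-type expansion, modulo `q ^ M`. -/
theorem hecke_expansion (M : ℕ) :
    (X : PowerSeries ℤ) ^ M ∣
      ∑ n ∈ Finset.range M, (-1) ^ n * X ^ tri n * ∑ r ∈ Finset.range (n + 1), boundedGF r -
      ∑ r ∈ Finset.range M, heckePoly r * (1 - X ^ (2 * r + 1)) * ((-1) ^ r * X ^ tri r) := by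
  have h : ∑ n ∈ Finset.range M, (-1) ^ n * X ^ tri n * ∑ r ∈ Finset.range (n + 1), boundedGF r =
      ∑ r ∈ Finset.range M, heckePoly r * (1 - X ^ (2 * r + 1)) *
        ∑ n ∈ Finset.range M, conjTerm n r := by
    simp only [Finset.mul_sum (s := Finset.range M)]
    rw [Finset.sum_comm]
    refine Finset.sum_congr rfl fun n hn => ?_
    rw [← bailey_pair, Finset.mul_sum]
    have hn' : n + 1 ≤ M := Finset.mem_range.1 hn
    rw [← Finset.sum_subset (Finset.range_subset_range.2 hn')]
    · refine Finset.sum_congr rfl fun r hr => ?_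
      rw [conjTerm, if_pos (Nat.lt_succ_iff.1 (Finset.mem_range.1 hr))]
      ring
    · intro r _ hr
      rw [conjTerm, if_neg (by simpa using hr)]
      ring
  rw [h, ← Finset.sum_sub_distrib]
  refine Finset.dvd_sum fun r _ => ?_
  rw [← mul_sub]
  exact (conjugate_pair M r).mul_left _

/-! ### Coefficients of the Hecke-type series -/

-- Passing from r to r + 1 raises the exponents with |j| ≤ r by 3r + 2, while j = r + 1 and j = -(r
-- + 1) contribute exponents 0 and r + 1: this is the recursion of `heckePoly`.
open PowerSeries in
theorem neg_one_pow_mul_heckePoly (r : ℕ) :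
    (-1) ^ r * heckePoly r = ∑ j ∈ Finset.Icc (-(r : ℤ)) r,
      (-1) ^ j.natAbs * (X : PowerSeries ℤ) ^ (((r : ℤ) * (3 * r + 1) - j * (3 * j + 1)) / 2).toNat := by
  induction r with
  | zero => simp [heckePoly]
  | succ r ih =>
    have hI : Finset.Icc (-((r + 1 : ℕ) : ℤ)) ((r + 1 : ℕ) : ℤ) =
        insert ((r + 1 : ℕ) : ℤ) (insert (-((r + 1 : ℕ) : ℤ)) (Finset.Icc (-(r : ℤ)) r)) := by
      ext j
      simp only [Finset.mem_insert, Finset.mem_Icc]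
      omega
    rw [hI, Finset.sum_insert (by simp; omega), Finset.sum_insert (by simp)]
    have h1 : ∑ j ∈ Finset.Icc (-(r : ℤ)) r, (-1) ^ j.natAbs * (X : PowerSeries ℤ) ^
        ((((r + 1 : ℕ) : ℤ) * (3 * ((r + 1 : ℕ) : ℤ) + 1) - j * (3 * j + 1)) / 2).toNat =
        X ^ (3 * r + 2) * ((-1) ^ r * heckePoly r) := by
      rw [ih, Finset.mul_sum]
      refine Finset.sum_congr rfl fun j hj => ?_
      rw [Finset.mem_Icc] at hj
      have hnn : 0 ≤ (r : ℤ) * (3 * r + 1) - j * (3 * j + 1) := by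
        nlinarith [mul_nonneg (sub_nonneg.2 hj.2) (neg_le_iff_add_nonneg.1 hj.1)]
      have he : ((r + 1 : ℕ) : ℤ) * (3 * ((r + 1 : ℕ) : ℤ) + 1) - j * (3 * j + 1) =
          ((r : ℤ) * (3 * r + 1) - j * (3 * j + 1)) + 2 * (3 * r + 2) := by
        push_cast; ring
      rw [he]
      generalize (r : ℤ) * (3 * r + 1) - j * (3 * j + 1) = a at hnn
      have : ((a + 2 * (3 * (r : ℤ) + 2)) / 2).toNat = (3 * r + 2) + (a / 2).toNat := by omega
      rw [this, pow_add]
      ring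
    have h2 : ((((r + 1 : ℕ) : ℤ) * (3 * ((r + 1 : ℕ) : ℤ) + 1) -
        -((r + 1 : ℕ) : ℤ) * (3 * -((r + 1 : ℕ) : ℤ) + 1)) / 2).toNat = r + 1 := by
      have : ((r + 1 : ℕ) : ℤ) * (3 * ((r + 1 : ℕ) : ℤ) + 1) -
        -((r + 1 : ℕ) : ℤ) * (3 * -((r + 1 : ℕ) : ℤ) + 1) = 2 * ((r + 1 : ℕ) : ℤ) := by ring
      rw [this]
      omega
    rw [h1, h2, sub_self, heckePoly, Int.natAbs_neg, Int.natAbs_natCast]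
    simp
    ring

/-- The pairs `(k, j)` with `2 |j| ≤ k` and `k(k+1)/2 - j(3j+1)/2 = n`. -/
noncomputable def heckeSet (n : ℕ) : Finset (ℕ × ℤ) :=
  (Finset.range (2 * (n + 1)) ×ˢ Finset.Icc (-(2 * n + 2) : ℤ) (2 * n + 2)).filter fun P =>
    2 * |P.2| ≤ P.1 ∧ (P.1 : ℤ) * (P.1 + 1) = P.2 * (3 * P.2 + 1) + 2 * n

theorem mem_heckeSet {n : ℕ} {P : ℕ × ℤ} :
    P ∈ heckeSet n ↔
      2 * |P.2| ≤ P.1 ∧ (P.1 : ℤ) * (P.1 + 1) = P.2 * (3 * P.2 + 1) + 2 * n := by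
  obtain ⟨k, j⟩ := P
  rw [heckeSet, Finset.mem_filter, Finset.mem_product, Finset.mem_range, Finset.mem_Icc]
  refine ⟨And.right, fun h => ⟨?_, h⟩⟩
  obtain ⟨h1, h2⟩ := h
  simp only at h1 h2 ⊢
  have h3 := abs_le.1 (show |j| ≤ (k : ℤ) / 2 by omega)
  have h4 : 2 * j ≤ k := by omega
  have h5 : -(k : ℤ) ≤ 2 * j := by omega
  have hk : (k : ℤ) < 2 * (n + 1) := by
    by_contra hc
    nlinarith [mul_nonneg (sub_nonneg.2 h4) (neg_le_iff_add_nonneg.1 h5)]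
  omega

-- Since r(3r+1)/2 + tri r = tri (2r) and tri (2r) + 2r + 1 = tri (2r + 1), the two terms of 1 -
-- q^(2r+1) give k = 2r and k = 2r + 1.
open PowerSeries in
theorem coeff_hecke_term (n r : ℕ) :
    coeff n (heckePoly r * (1 - X ^ (2 * r + 1)) * ((-1) ^ r * X ^ tri r)) =
      (∑ j ∈ Finset.Icc (-(r : ℤ)) r, if ((2 * r : ℕ) : ℤ) * ((2 * r : ℕ) + 1) =
        j * (3 * j + 1) + 2 * n then (-1) ^ (2 * r + j.natAbs) else 0) +
      ∑ j ∈ Finset.Icc (-(r : ℤ)) r, if ((2 * r + 1 : ℕ) : ℤ) * ((2 * r + 1 : ℕ) + 1) =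
        j * (3 * j + 1) + 2 * n then (-1) ^ (2 * r + 1 + j.natAbs) else 0 := by
  have h : heckePoly r * (1 - X ^ (2 * r + 1)) * ((-1) ^ r * X ^ tri r) =
      ((-1) ^ r * heckePoly r) * ((1 - X ^ (2 * r + 1)) * X ^ tri r) := by ring
  rw [h, neg_one_pow_mul_heckePoly, Finset.sum_mul, map_sum, ← Finset.sum_add_distrib]
  refine Finset.sum_congr rfl fun j hj => ?_
  rw [Finset.mem_Icc] at hj
  have hnn : 0 ≤ (r : ℤ) * (3 * r + 1) - j * (3 * j + 1) := by
    nlinarith [mul_nonneg (sub_nonneg.2 hj.2) (neg_le_iff_add_nonneg.1 hj.1)]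
  obtain ⟨a, ha⟩ : ∃ a : ℕ, (r : ℤ) * (3 * r + 1) - j * (3 * j + 1) = 2 * a := by
    have h1 : Even ((r : ℤ) * (3 * r + 1) - j * (3 * j + 1)) := by
      simp only [Int.even_sub, Int.even_mul, Int.even_add]
      have : ¬ Even (3 : ℤ) := by decide
      tauto
    obtain ⟨b, hb⟩ := h1
    exact ⟨b.toNat, by omega⟩
  have ht : (2 : ℤ) * tri r = r * (r + 1) := by exact_mod_cast two_mul_tri r
  have e1 : ((2 * r : ℕ) : ℤ) * ((2 * r : ℕ) + 1) = j * (3 * j + 1) + 2 * n ↔ n = a + tri r := by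
    push_cast
    constructor
    · intro h
      zify
      linarith
    · intro h
      rw [h]
      push_cast
      linarith
  have e2 : ((2 * r + 1 : ℕ) : ℤ) * ((2 * r + 1 : ℕ) + 1) = j * (3 * j + 1) + 2 * n ↔
      n = a + (2 * r + 1) + tri r := by
    push_cast
    constructor
    · intro h
      zify
      linarith
    · intro h
      rw [h]
      push_cast
      linarith
  simp only [e1, e2, ha]
  have e3 : ((2 * (a : ℤ)) / 2).toNat = a := by omega
  rw [e3]
  have e4 : (-1) ^ j.natAbs * X ^ a * ((1 - X ^ (2 * r + 1)) * X ^ tri r) =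
      PowerSeries.C ((-1 : ℤ) ^ j.natAbs) * (X ^ (a + tri r) - X ^ (a + (2 * r + 1) + tri r)) := by
    rw [map_pow, map_neg, map_one]
    ring
  rw [e4, coeff_C_mul, map_sub, coeff_X_pow, coeff_X_pow]
  have e5 : (-1 : ℤ) ^ (2 * r + j.natAbs) = (-1) ^ j.natAbs := by simp [pow_add, pow_mul]
  have e6 : (-1 : ℤ) ^ (2 * r + 1 + j.natAbs) = -(-1) ^ j.natAbs := by simp [pow_add, pow_mul]
  rw [e5, e6]
  split_ifs <;> ring

open PowerSeries in
theorem coeff_hecke_sum (n : ℕ) :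
    coeff n (∑ r ∈ Finset.range (n + 1),
      heckePoly r * (1 - X ^ (2 * r + 1)) * ((-1) ^ r * X ^ tri r)) =
    ∑ P ∈ heckeSet n, (-1) ^ (P.1 + P.2.natAbs) := by
  let f (k : ℕ) : ℤ := ∑ j ∈ Finset.Icc (-((k / 2 : ℕ) : ℤ)) (k / 2 : ℕ),
    if (k : ℤ) * (k + 1) = j * (3 * j + 1) + 2 * n then (-1) ^ (k + j.natAbs) else 0
  have hf : ∀ M, ∑ k ∈ Finset.range (2 * M), f k =
      ∑ r ∈ Finset.range M, (f (2 * r) + f (2 * r + 1)) := by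
    intro M
    induction M with
    | zero => rfl
    | succ M ih =>
      rw [Finset.sum_range_succ, ← ih, mul_add, Finset.sum_range_succ, Finset.sum_range_succ]
      ring
  have h1 : ∀ r, f (2 * r) + f (2 * r + 1) =
      coeff n (heckePoly r * (1 - X ^ (2 * r + 1)) * ((-1) ^ r * X ^ tri r)) := by
    intro r
    rw [coeff_hecke_term]
    simp only [f]
    rw [show 2 * r / 2 = r by omega, show (2 * r + 1) / 2 = r by omega]
  rw [map_sum, ← Finset.sum_congr rfl fun r _ => h1 r, ← hf, heckeSet, Finset.sum_filter,
    Finset.sum_product]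
  refine Finset.sum_congr rfl fun k hk => ?_
  rw [Finset.mem_range] at hk
  have hs : Finset.Icc (-((k / 2 : ℕ) : ℤ)) (k / 2 : ℕ) =
      (Finset.Icc (-(2 * n + 2) : ℤ) (2 * n + 2)).filter fun j : ℤ => 2 * |j| ≤ k := by
    ext j
    rw [Finset.mem_filter, Finset.mem_Icc, Finset.mem_Icc]
    rcases abs_cases j with h | h <;> omega
  simp only [f]
  rw [hs, Finset.sum_filter]
  refine Finset.sum_congr rfl fun j _ => ?_
  rw [← ite_and]

/-! ### Combinatorics of ω -/

theorem sum_Icc_one_val (N : ℕ) : (Finset.Icc 1 N).val.sum = tri N := by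
  induction N with
  | zero => rfl
  | succ N ih =>
    have h := Finset.sum_Icc_succ_top (Nat.le_add_left 1 N) fun i => i
    rw [Finset.sum_eq_multiset_sum, Finset.sum_eq_multiset_sum, Multiset.map_id',
      Multiset.map_id', ih] at h
    rw [h, tri_succ]

theorem count_Icc_one_val (N i : ℕ) :
    (Finset.Icc 1 N).val.count i = if 1 ≤ i ∧ i ≤ N then 1 else 0 := by
  rw [Multiset.count_eq_of_nodup (Finset.nodup _)]
  simp

theorem Icc_one_val_le_of_count {r N : ℕ} {s : Multiset ℕ}
    (h1 : ∀ i ∈ Finset.Icc 1 r, 1 ≤ s.count i) (h2 : ∀ i ∈ Finset.Ioc r N, s.count i = 1) :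
    (Finset.Icc 1 N).val ≤ s := by
  rw [Multiset.le_iff_count]
  intro i
  rw [count_Icc_one_val]
  split_ifs with hi
  · rcases le_or_gt i r with hr | hr
    · exact h1 i (Finset.mem_Icc.2 ⟨hi.1, hr⟩)
    · exact (h2 i (Finset.mem_Ioc.2 ⟨hr, hi.2⟩)).ge
  · exact Nat.zero_le _

/-- Removing one copy of each part `1, …, N`. -/
theorem partitionCount_eq_card (r N m : ℕ) (h : r ≤ N) :
    partitionCount r N (tri N + m) = (Nat.Partition.restricted m (· ≤ r)).card := by
  rw [← Nat.subtype_card (p := fun p : m.Partition => ∀ i ∈ p.parts, i ≤ r) _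
    (fun p => by simp [Nat.Partition.restricted]), partitionCount]
  symm
  have hzero : ∀ p : m.Partition, (∀ i ∈ p.parts, i ≤ r) → ∀ i, r < i → p.parts.count i = 0 :=
    fun p hp i hi => Multiset.count_eq_zero.2 fun hm => absurd (hp i hm) (by omega)
  refine Nat.card_eq_of_bijective (fun p => ⟨⟨p.1.parts + (Finset.Icc 1 N).val, ?_, ?_⟩, ?_⟩)
    ⟨?_, ?_⟩
  · intro i hi
    rcases Multiset.mem_add.1 hi with hi | hi
    · exact p.1.parts_pos hi
    · exact (Finset.mem_Icc.1 (Finset.mem_def.2 hi)).1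
  · rw [Multiset.sum_add, p.1.parts_sum, sum_Icc_one_val, add_comm]
  · refine ⟨fun i hi => ?_, fun i hi => ?_, fun i hi => ?_⟩
    · rcases Multiset.mem_add.1 hi with hi | hi
      · exact (p.2 i hi).trans h
      · exact (Finset.mem_Icc.1 (Finset.mem_def.2 hi)).2
    · rw [Finset.mem_Icc] at hi
      rw [Multiset.count_add, count_Icc_one_val, if_pos ⟨hi.1, hi.2.trans h⟩]
      omega
    · rw [Finset.mem_Ioc] at hi
      rw [Multiset.count_add, count_Icc_one_val, if_pos ⟨by omega, hi.2⟩, hzero p.1 p.2 i hi.1]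
  · intro p p' hpp
    have := congrArg (fun x => x.1.parts) hpp
    exact Subtype.ext (Nat.Partition.ext (add_right_cancel this))
  · rintro ⟨π, h0, h1, h2⟩
    have hle := Icc_one_val_le_of_count h1 h2
    have hadd := tsub_add_cancel_of_le hle
    refine ⟨⟨⟨π.parts - (Finset.Icc 1 N).val, ?_, ?_⟩, ?_⟩, ?_⟩
    · intro i hi
      exact π.parts_pos (Multiset.mem_of_le tsub_le_self hi)
    · have := congrArg Multiset.sum hadd
      rw [Multiset.sum_add, π.parts_sum, sum_Icc_one_val] at this
      omega
    · intro i hi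
      by_contra hc
      have hi' := Multiset.mem_of_le tsub_le_self hi
      have hiN := h0 i hi'
      have := Multiset.count_pos.2 hi
      rw [Multiset.count_sub, h2 i (Finset.mem_Ioc.2 ⟨by omega, hiN⟩), count_Icc_one_val,
        if_pos ⟨by omega, hiN⟩] at this
      omega
    · exact Subtype.ext (Nat.Partition.ext hadd)

theorem tri_le_of_partitionCount_ne_zero {r N n : ℕ} (h : partitionCount r N n ≠ 0) :
    tri N ≤ n := by
  obtain ⟨⟨π, h0, h1, h2⟩⟩ := (Nat.card_ne_zero.1 h).1
  have hadd := congrArg Multiset.sum (tsub_add_cancel_of_le (Icc_one_val_le_of_count h1 h2))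
  rw [Multiset.sum_add, π.parts_sum, sum_Icc_one_val] at hadd
  omega

open PowerSeries in
theorem coeff_eq_partitionCount {r N : ℕ} (n : ℕ) (h : r ≤ N) :
    coeff n (X ^ tri N * boundedGF r) = (partitionCount r N n : ℤ) := by
  rw [coeff_X_pow_mul']
  split_ifs with hn
  · obtain ⟨m, rfl⟩ := Nat.exists_eq_add_of_le hn
    rw [partitionCount_eq_card r N m h, Nat.add_sub_cancel_left, boundedGF, coeff_mk]
  · have : partitionCount r N n = 0 := by
      by_contra hc
      exact hn (tri_le_of_partitionCount_ne_zero hc)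
    rw [this, Nat.cast_zero]

theorem omegaSupport_finite (n : ℕ) : (omegaSupport n).Finite := by
  refine (Finset.range (n + 1) ×ˢ Finset.range (n + 1)).finite_toSet.subset ?_
  rintro ⟨N, r⟩ ⟨h1, h2⟩
  have := le_tri N
  have := tri_le_of_partitionCount_ne_zero h2
  simp only at *
  rw [Finset.mem_coe, Finset.mem_product, Finset.mem_range, Finset.mem_range]
  constructor <;> simp only <;> omega

open PowerSeries in
theorem omega_eq_coeff (n : ℕ) :
    omega n = coeff n (∑ N ∈ Finset.range (n + 1),
      (-1) ^ N * X ^ tri N * ∑ r ∈ Finset.range (N + 1), boundedGF r) := by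
  have h := finsum_mem_eq_sum_of_inter_support_eq
    (fun P : ℕ × ℕ => (-1 : ℤ) ^ P.1 * (partitionCount P.2 P.1 n : ℤ))
    (s := {P : ℕ × ℕ | P.2 ≤ P.1})
    (t := (Finset.range (n + 1) ×ˢ Finset.range (n + 1)).filter fun P => P.2 ≤ P.1) (by
      ext ⟨N, r⟩
      simp only [Set.mem_inter_iff, Set.mem_ofPred_eq, Function.mem_support, Finset.mem_coe,
        Finset.mem_filter, Finset.mem_product, Finset.mem_range, and_congr_left_iff]
      intro hne
      have h1 := le_tri N
      have h2 := tri_le_of_partitionCount_ne_zero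
        (Nat.cast_ne_zero.1 (right_ne_zero_of_mul hne))
      omega)
  rw [omega, h, Finset.sum_filter, Finset.sum_product, map_sum]
  refine Finset.sum_congr rfl fun N hN => ?_
  rw [Finset.mem_range] at hN
  have hC : (-1) ^ N * X ^ tri N * ∑ r ∈ Finset.range (N + 1), boundedGF r =
      C ((-1 : ℤ) ^ N) * ∑ r ∈ Finset.range (N + 1), X ^ tri N * boundedGF r := by
    rw [map_pow, map_neg, map_one, Finset.mul_sum, Finset.mul_sum]
    exact Finset.sum_congr rfl fun r _ => mul_assoc _ _ _
  have hr : (Finset.range (n + 1)).filter (fun r => r ≤ N) = Finset.range (N + 1) := by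
    ext r
    simp only [Finset.mem_filter, Finset.mem_range]
    omega
  rw [hC, coeff_C_mul, map_sum, ← Finset.sum_filter, hr, Finset.mul_sum]
  refine Finset.sum_congr rfl fun r hr => ?_
  rw [coeff_eq_partitionCount n (Nat.lt_succ_iff.1 (Finset.mem_range.1 hr))]

open PowerSeries in
theorem omega_eq_sum (n : ℕ) : omega n = ∑ P ∈ heckeSet n, (-1) ^ (P.1 + P.2.natAbs) := by
  rw [omega_eq_coeff, ← coeff_hecke_sum, ← sub_eq_zero, ← map_sub]
  exact X_pow_dvd_iff.1 (hecke_expansion (n + 1)) n (Nat.lt_succ_self n)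

/-! ### The norm equation and its fundamental domain -/

/-- The class of the solution `(6j + 1, 2k + 1)`. -/
def heckeClass (P : ℕ × ℤ) : Quotient solutionSetoid :=
  Quotient.mk solutionSetoid (6 * P.2 + 1, 2 * P.1 + 1)

theorem false_of_unit_pos {x y x' y' a b : ℤ} (hy : 0 < y) (hab : a ^ 2 - 3 * b ^ 2 = 1)
    (hx' : x' = a * x + 3 * b * y) (hy' : y' = b * x + a * y) (ha : 0 < a) (hb : 0 < b)
    (ha3 : a % 3 = 1) (h1 : -(3 * y) < 2 * x) (h2 : 2 * x' < 3 * y') : False := by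
  -- The unit 7 + 4√3 maps the ray 2x = -3y to 2x = 3y; staying inside the cone forces a smaller
  -- unit. With a² = 1 + 3b² only 2 + √3 remains, and a ≡ 1 (mod 3) excludes it.
  have h3 : 7 * b < 4 * a := by
    by_contra hc
    push Not at hc
    have h4 : 3 * b < 2 * a := by nlinarith
    have h5 : 0 < (2 * a - 3 * b) * (2 * x + 3 * y) := mul_pos (by linarith) (by linarith)
    have h6 : 0 ≤ y * (7 * b - 4 * a) := mul_nonneg hy.le (by linarith)
    rw [hx', hy'] at h2
    linarith
  have hb4 : b < 4 := by nlinarith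
  have ha7 : a < 7 := by nlinarith
  interval_cases b <;> interval_cases a <;> omega

theorem eq_of_equiv_of_fundamental {x y x' y' : ℤ} (hy : 0 < y) (hy' : 0 < y')
    (h1 : 2 * |x| < 3 * y) (h2 : 2 * |x'| < 3 * y') (hx3 : x % 3 = 1) (hx3' : x' % 3 = 1)
    (h : ∃ a b : ℤ, a ^ 2 - 3 * b ^ 2 = 1 ∧ x' = a * x + 3 * b * y ∧ y' = b * x + a * y) :
    x = x' ∧ y = y' := by
  obtain ⟨a, b, hab, e1, e2⟩ := h
  have l1 := abs_lt.1 (show |2 * x| < 3 * y by rw [abs_mul]; simpa using h1)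
  have l2 := abs_lt.1 (show |2 * x'| < 3 * y' by rw [abs_mul]; simpa using h2)
  have ha3 : a % 3 = 1 := by
    have : x' % 3 = (a % 3) * (x % 3) % 3 := by
      rw [e1, ← Int.mul_emod, show a * x + 3 * b * y = a * x + 3 * (b * y) by ring,
        Int.add_mul_emod_self_left]
    rw [hx3, hx3'] at this
    omega
  -- If a < 0, then |bx| < -ay in the cone, so y' would be negative.
  have ha : 0 < a := by
    by_contra hc
    have hc' : a < 0 := by omega
    have hbx : |b| * (2 * |x|) ≤ |b| * (3 * y) := mul_le_mul_of_nonneg_left h1.le (abs_nonneg b)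
    have hba : 3 * |b| < 2 * -a := by
      have := sq_abs b
      nlinarith [abs_nonneg b]
    have := le_abs_self (b * x)
    rw [abs_mul] at this
    nlinarith
  rcases lt_trichotomy b 0 with hb | hb | hb
  -- Reflecting x reduces b < 0 to b > 0.
  · refine (false_of_unit_pos (x := -x) (y := y) (x' := -x') (y' := y') (a := a) (b := -b)
      hy (by linarith [neg_sq b]) (by rw [e1]; ring) (by rw [e2]; ring) ha (by omega) ha3
      (by linarith) (by linarith)).elim
  · subst hb
    have : a = 1 := by nlinarith
    subst this
    constructor <;> linarith
  · exact (false_of_unit_pos hy hab e1 e2 ha hb ha3 l1.1 l2.2).elim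

/-- Every solution with `y` odd is equivalent to one in the fundamental domain with the
same residue of `x + 3y`. -/
theorem exists_fundamental (m c : ℤ) (hm : 0 < m) (hc : Even c) (Y : ℕ) :
    ∀ x y : ℤ, y.toNat ≤ Y → -m = x ^ 2 - 3 * y ^ 2 → 0 < y → y % 2 = 1 →
      x + 3 * y ≡ c [ZMOD 12] →
      ∃ x' y' : ℤ, solutionSetoid (x, y) (x', y') ∧ -m = x' ^ 2 - 3 * y' ^ 2 ∧ 0 < y' ∧
        x' + 3 * y' ≡ c [ZMOD 12] ∧ 2 * |x'| < 3 * y' := by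
  obtain ⟨d, hd⟩ := hc
  induction Y with
  | zero => intro x y h1 _ h2; omega
  | succ Y ih =>
    intro x y hY he hy hy2 hcong
    have h12 := hcong
    rw [Int.modEq_iff_dvd] at hcong
    obtain ⟨e, hce⟩ := hcong
    rcases lt_or_ge (2 * |x|) (3 * y) with h | h
    · exact ⟨x, y, solutionSetoid.refl _, he, hy, h12, h⟩
    · rcases abs_cases x with ⟨h1, h2⟩ | ⟨h1, h2⟩ <;> rw [h1] at h
      -- Descent by 7 - 4√3: x² < 3y² keeps the new y positive, and 2x > 3y (strict, as y is odd)
      -- makes it smaller. The sum x + 3y changes by 6(y - x), a multiple of 12 because c even makes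
      -- x odd.
      · have hpos : 4 * x < 7 * y := by nlinarith
        obtain ⟨x', y', hs, hr⟩ := ih (7 * x - 12 * y) (-4 * x + 7 * y) (by omega)
          (by rw [he]; ring) (by omega) (by omega)
          (by rw [Int.modEq_iff_dvd]; omega)
        exact ⟨x', y', solutionSetoid.trans
          ⟨7, -4, by norm_num, by ring, by ring⟩ hs, hr⟩
      · have hpos : -4 * x < 7 * y := by nlinarith
        obtain ⟨x', y', hs, hr⟩ := ih (7 * x + 12 * y) (4 * x + 7 * y) (by omega)
          (by rw [he]; ring) (by omega) (by omega)
          (by rw [Int.modEq_iff_dvd]; omega)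
        exact ⟨x', y', solutionSetoid.trans
          ⟨7, 4, by norm_num, by ring, by ring⟩ hs, hr⟩

/-- For y even, x² - 3y² is 0 or 1 mod 4, never 2. -/
theorem odd_of_solution {n x y : ℤ} (h : -(24 * n + 2) = x ^ 2 - 3 * y ^ 2) : y % 2 = 1 := by
  by_contra hc
  obtain ⟨z, hz⟩ : ∃ z, y = 2 * z := ⟨y / 2, by omega⟩
  subst hz
  rcases Int.emod_two_eq_zero_or_one x with hx | hx
  · obtain ⟨w, hw⟩ : ∃ w, x = 2 * w := ⟨x / 2, by omega⟩
    subst hw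
    ring_nf at h
    omega
  · obtain ⟨w, hw⟩ : ∃ w, x = 2 * w + 1 := ⟨x / 2, by omega⟩
    subst hw
    ring_nf at h
    omega

theorem heckeClass_injOn (n : ℕ) : Set.InjOn heckeClass (heckeSet n : Set (ℕ × ℤ)) := by
  rintro ⟨k, j⟩ hP ⟨k', j'⟩ hP' h
  rw [Finset.mem_coe, mem_heckeSet] at hP hP'
  have hdom : ∀ (k : ℕ) (j : ℤ), 2 * |j| ≤ k → 2 * |6 * j + 1| < 3 * (2 * (k : ℤ) + 1) := by
    intro k j hj
    rcases abs_cases j with h | h <;> rcases abs_cases (6 * j + 1) with h' | h' <;> omega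
  have hkey := eq_of_equiv_of_fundamental (by positivity) (by positivity)
    (hdom k j hP.1) (hdom k' j' hP'.1) (by omega) (by omega) (Quotient.exact h)
  ext <;> simp only <;> omega

/-- The parameter e treats both residues at once: e = 0 gives 4 and e = 1 gives 10. -/
theorem solutionClasses_eq (n : ℕ) (e : ℤ) :
    solutionClasses (24 * (n : ℤ) + 2) (6 * e + 4) =
      heckeClass '' {P | P ∈ heckeSet n ∧ (P.1 + P.2 - e) % 2 = 0} := by
  ext q
  constructor
  · rintro ⟨⟨x, y⟩, ⟨h1, h2, h3⟩, rfl⟩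
    obtain ⟨x', y', hs, g1, g2, g3, g4⟩ := exists_fundamental _ _ (by positivity)
      (⟨3 * e + 2, by ring⟩) _ x y le_rfl h1 h2 (odd_of_solution h1) h3
    have hy := odd_of_solution g1
    rw [Int.modEq_iff_dvd] at g3
    obtain ⟨f, hf⟩ := g3
    obtain ⟨k, rfl⟩ : ∃ k : ℕ, y' = 2 * k + 1 := ⟨(y' / 2).toNat, by omega⟩
    obtain ⟨j, rfl⟩ : ∃ j : ℤ, x' = 6 * j + 1 := ⟨x' / 6, by omega⟩
    refine ⟨(k, j), ⟨mem_heckeSet.2 ⟨?_, ?_⟩, ?_⟩, (Quotient.sound hs).symm⟩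
    · simp only
      rcases abs_cases j with h | h <;> rcases abs_cases (6 * j + 1) with h' | h' <;> omega
    · simp only
      linarith
    · simp only
      omega
  · rintro ⟨⟨k, j⟩, ⟨hP, he⟩, rfl⟩
    rw [mem_heckeSet] at hP
    simp only at hP he
    refine ⟨(6 * j + 1, 2 * k + 1), ⟨?_, ?_, ?_⟩, rfl⟩
    · simp only
      linarith [hP.2]
    · simp only
      positivity
    · simp only
      rw [Int.modEq_iff_dvd]
      omega

theorem ncard_solutionClasses (n : ℕ) (e : ℤ) :
    (solutionClasses (24 * (n : ℤ) + 2) (6 * e + 4)).ncard =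
      ((heckeSet n).filter fun P => (P.1 + P.2 - e) % 2 = 0).card := by
  rw [solutionClasses_eq, ((heckeClass_injOn n).mono fun P hP => hP.1).ncard_image,
    ← Set.ncard_coe_finset]
  congr 1
  ext P
  simp

theorem solutionClasses_finite (n : ℕ) (e : ℤ) :
    (solutionClasses (24 * (n : ℤ) + 2) (6 * e + 4)).Finite := by
  rw [solutionClasses_eq]
  exact ((heckeSet n).finite_toSet.subset fun P hP => hP.1).image _

theorem theorem1p1 (n : ℕ) :
    (omegaSupport n).Finite ∧
    (solutionClasses (24 * (n : ℤ) + 2) 4).Finite ∧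
    (solutionClasses (24 * (n : ℤ) + 2) 10).Finite ∧
    omega n = excess (24 * (n : ℤ) + 2) := by
  refine ⟨omegaSupport_finite n, solutionClasses_finite n 0, solutionClasses_finite n 1, ?_⟩
  have h0 := ncard_solutionClasses n 0
  have h1 := ncard_solutionClasses n 1
  norm_num at h0 h1
  rw [omega_eq_sum, excess, h0, h1, Finset.card_filter, Finset.card_filter]
  push_cast
  rw [← Finset.sum_sub_distrib]
  refine Finset.sum_congr rfl fun P _ => ?_
  rcases Nat.even_or_odd (P.1 + P.2.natAbs) with h | h
  · rw [h.neg_one_pow, if_pos, if_neg] <;> grind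
  · rw [h.neg_one_pow, if_neg, if_pos] <;> grind
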